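/- The game of Cops and Robbers with $k$ cops on a finite simple graph $G$ is played as follows. In round $0$ each of the $k$ cops chooses a vertex, and then the robber chooses a vertex; in every later round each cop stays or moves along an edge, and then the robber stays or moves along an edge. Several cops may share a vertex, and both sides always see all positions. The robber is captured in the first round during which some cop occupies the robber's vertex. A vertex is damaged if the robber occupies it at the start of some round $t\ge 1$ and is not captured in round $t$ or earlier. Let $\operatorname{capt}_k(G)$ be the least $m \in \{0,1,2,\dots\}\cup\{\infty\}$ such that $k$ cops have a strategy under which, however the robber plays, the robber is captured in round at most $m$ (where $m=\infty$ imposes no condition), and let $\operatorname{dmg}_k(G)$ be the least $m$ such that $k$ cops have a strategy under which, however the robber plays, at most $m$ vertices are ever damaged. For a graph $G$ with $n$ vertices put \[ \operatorname{th}_c(G)=\min_{1\le k\le n}\{k+\operatorname{capt}_k(G)\},\qquad \operatorname{th}_d(G)=\min_{1\le k\le n}\{k+\operatorname{dmg}_k(G)\}. \] A graph is chordal if every induced cycle in it is a triangle. Statement: every connected chordal graph $G$ with at least two vertices satisfies \[ \operatorname{th}_d(G)=\operatorname{th}_c(G)-1 . \] -/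

import Mathlib

namespace CopsRobbers

variable {V : Type*}

/-- A simple graph is chordal if every induced cycle is a triangle. -/
def IsChordal (G : SimpleGraph V) : Prop :=
  ∀ m : ℕ, 3 ≤ m → (SimpleGraph.cycleGraph m).IsIndContained G → m = 3

/-- A (perfect information) strategy for `k` cops on `G`. The argument of `pos` is the list of the
robber positions chosen so far, most recent first: `pos []` is the placement of the cops in round
`0`, and `pos [r_t, …, r_0]` is their position after their move in round `t + 1`. In each round
every cop stays or moves along an edge. -/
structure CopStrategy (G : SimpleGraph V) (k : ℕ) where
  pos : List V → Fin k → V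
  legal : ∀ (h : List V) (v : V) (i : Fin k),
    pos (v :: h) i = pos h i ∨ G.Adj (pos h i) (pos (v :: h) i)

/-- A sequence of robber positions: `pos 0` is the placement in round `0`, and `pos t` is the
position after the robber's move in round `t`. In each round the robber stays or moves along an
edge. (The part of the sequence that follows a capture is irrelevant below.) -/
structure RobberPlay (G : SimpleGraph V) where
  pos : ℕ → V
  legal : ∀ t : ℕ, pos (t + 1) = pos t ∨ G.Adj (pos t) (pos (t + 1))

/-- The robber positions of rounds `0, …, t - 1`, most recent first. -/
def RobberPlay.history {G : SimpleGraph V} (r : RobberPlay G) : ℕ → List V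
  | 0 => []
  | t + 1 => r.pos t :: r.history t

/-- The position of the cops in round `t` (after their move) when they answer the play `r`. -/
def CopStrategy.posAt {G : SimpleGraph V} {k : ℕ} (σ : CopStrategy G k) (r : RobberPlay G)
    (t : ℕ) : Fin k → V :=
  σ.pos (r.history t)

/-- Some cop is on the robber's vertex at some moment of the given round: in round `0`, after the
robber's placement; in a later round, after the cops' move or after the robber's move. -/
def CaughtIn {G : SimpleGraph V} {k : ℕ} (σ : CopStrategy G k) (r : RobberPlay G) : ℕ → Prop
  | 0 => ∃ i, σ.posAt r 0 i = r.pos 0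
  | t + 1 => ∃ i, σ.posAt r (t + 1) i = r.pos t ∨ σ.posAt r (t + 1) i = r.pos (t + 1)

/-- The round in which the robber is captured, `⊤` if this never happens. -/
noncomputable def captureRound {G : SimpleGraph V} {k : ℕ} (σ : CopStrategy G k)
    (r : RobberPlay G) : ℕ∞ :=
  ⨅ (t : ℕ) (_ : CaughtIn σ r t), (t : ℕ∞)

/-- The damaged vertices: those on which the robber starts some round `t + 1` such that no capture
occurs up to and including that round. -/
def damaged {G : SimpleGraph V} {k : ℕ} (σ : CopStrategy G k) (r : RobberPlay G) : Set V :=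
  {v | ∃ t : ℕ, r.pos t = v ∧ ∀ s ≤ t + 1, ¬ CaughtIn σ r s}

/-- The `k`-capture time of `G` (`⊤` if `k` cops cannot guarantee capture). -/
noncomputable def capt (G : SimpleGraph V) (k : ℕ) : ℕ∞ :=
  ⨅ σ : CopStrategy G k, ⨆ r : RobberPlay G, captureRound σ r

/-- The `k`-damage number of `G`. -/
noncomputable def dmg (G : SimpleGraph V) (k : ℕ) : ℕ∞ :=
  ⨅ σ : CopStrategy G k, ⨆ r : RobberPlay G, (damaged σ r).encard

/-- The cop throttling number of `G`. -/
noncomputable def copThrottling [Fintype V] (G : SimpleGraph V) : ℕ∞ :=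
  ⨅ k ∈ Finset.Icc 1 (Fintype.card V), ((k : ℕ∞) + capt G k)

/-- The damage throttling number of `G`. -/
noncomputable def damageThrottling [Fintype V] (G : SimpleGraph V) : ℕ∞ :=
  ⨅ k ∈ Finset.Icc 1 (Fintype.card V), ((k : ℕ∞) + dmg G k)

end CopsRobbers

/-! ### Robber territories and separators in chordal graphs -/

namespace CopsRobbers

open Relation

variable {V : Type*}

/-! For `k` cops, fewer than the number `n` of vertices, `dmg + 1 ≤ capt` is bookkeeping: a capture
in round `c ≥ 1` leaves at most `c - 1` damaged vertices. The case `k = n` is absorbed by `n - 1`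
cops, who win within one round.

The substance is `capt ≤ dmg + 1` for `k ≥ 1`: a robber able to survive `m` rounds can damage `m`
distinct vertices. He imagines shadow cops `Q i`, each of which dominates the real cop: his
component outside the closed neighbourhood of `Q i` (his territory) contains nothing the real cop
can reach in one move. By chordality a shadow can answer every real move so that domination persists
and territories only shrink (`exists_dominates`). A shadow at distance two can even step next to the
robber (`exists_dominates_attack`). Playing to survive against the shadows, he must then move, ends
again at distance two from the attacker, and the vacated vertex has left that territory for good. So
every round damages a new vertex (`canDamage`). A starting vertex at distance two from a cop comes
from `exists_survives_near`. -/

/-- The closed neighbourhood of a vertex. -/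
def closedNbhd (G : SimpleGraph V) (a : V) : Set V := {v | v = a ∨ G.Adj a v}

/-- `v` can be reached from `r` along vertices outside `X`. -/
def Avoids (G : SimpleGraph V) (X : Set V) : V → V → Prop :=
  ReflTransGen fun x y => G.Adj x y ∧ x ∉ X ∧ y ∉ X

section Avoids

variable {G : SimpleGraph V} {X Y : Set V} {r s v : V}

theorem Avoids.not_mem (h : Avoids G X r v) (hr : r ∉ X) : v ∉ X := by
  induction h with
  | refl => exact hr
  | tail _ h _ => exact h.2.2

theorem Avoids.symm (h : Avoids G X r v) : Avoids G X v r := by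
  induction h with
  | refl => exact .refl
  | tail _ h ih => exact ih.head ⟨h.1.symm, h.2.2, h.2.1⟩

theorem Avoids.step (h : Avoids G X r v) (hr : r ∉ X) (hs : s = v ∨ G.Adj v s) (hX : s ∉ X) :
    Avoids G X r s := by
  rcases hs with rfl | hs
  · exact h
  · exact h.tail ⟨hs, h.not_mem hr, hX⟩

theorem Avoids.anti (h : Avoids G X r v) (hXY : Y ⊆ X) : Avoids G Y r v := by
  induction h with
  | refl => exact .refl
  | tail _ h ih => exact ih.tail ⟨h.1, fun hx => h.2.1 (hXY hx), fun hx => h.2.2 (hXY hx)⟩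

end Avoids

section Chordal

variable {G : SimpleGraph V}

/-- A path with given ends whose inner vertices lie outside `X`. -/
def IsDetour (G : SimpleGraph V) (X : Set V) (u v : V) (n : ℕ) (f : ℕ → V) : Prop :=
  f 0 = u ∧ f n = v ∧ (∀ i < n, G.Adj (f i) (f (i + 1))) ∧ ∀ i, 0 < i → i < n → f i ∉ X

theorem Avoids.exists_isDetour {X : Set V} {u x y v : V} (h : Avoids G X x y) (hx : x ∉ X)
    (hux : G.Adj u x) (hyv : G.Adj y v) : ∃ n f, IsDetour G X u v n f := by
  induction h generalizing v with
  | refl =>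
    refine ⟨2, fun i => if i = 0 then u else if i = 1 then x else v, by simp, by simp, ?_, ?_⟩
    · intro i hi
      interval_cases i
      · simpa using hux
      · simpa using hyv
    · intro i h0 h2
      obtain rfl : i = 1 := by omega
      simpa using hx
  | @tail y z hxy hyz ih =>
    obtain ⟨n, f, h0, hn, hadj, hX⟩ := ih hyz.1
    refine ⟨n + 1, fun i => if i ≤ n then f i else v, by simpa using h0, by simp, ?_, ?_⟩
    · intro i hi
      rcases Nat.lt_succ_iff_lt_or_eq.mp hi with hi | rfl
      · simpa [hi.le, Nat.succ_le_of_lt hi] using hadj i hi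
      · simpa [hn] using hyv
    · intro i hi0 hi
      have hin : i ≤ n := Nat.lt_succ_iff.mp hi
      simp only [hin, if_true]
      rcases hin.lt_or_eq with h | rfl
      · exact hX i hi0 h
      · rw [hn]; exact hyz.2.2

theorem IsDetour.shortcut {X : Set V} {u v : V} {n : ℕ} {f : ℕ → V} (hf : IsDetour G X u v n f)
    {i j : ℕ} (hij : i + 1 < j) (hj : j ≤ n) (h : G.Adj (f i) (f j)) :
    ∃ m < n, ∃ g, IsDetour G X u v m g := by
  obtain ⟨h0, hn, hadj, hX⟩ := hf
  refine ⟨n - (j - i - 1), by omega, fun k => if k ≤ i then f k else f (k + (j - i - 1)),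
    by simpa using h0, ?_, ?_, ?_⟩
  · have h1 : ¬ n - (j - i - 1) ≤ i := by omega
    have h2 : n - (j - i - 1) + (j - i - 1) = n := by omega
    simp only [h1, if_false, h2, hn]
  · intro k hk
    rcases lt_trichotomy k i with hki | rfl | hki
    · have h1 : k + 1 ≤ i := hki
      simpa only [hki.le, h1, if_true] using hadj k (by omega)
    · have h1 : ¬ k + 1 ≤ k := by omega
      have h2 : k + 1 + (j - k - 1) = j := by omega
      simpa only [le_refl, h1, if_true, if_false, h2] using h
    · have h1 : ¬ k ≤ i := by omega
      have h2 : ¬ k + 1 ≤ i := by omega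
      have h3 : k + 1 + (j - i - 1) = k + (j - i - 1) + 1 := by omega
      simpa only [h1, h2, if_false, h3] using hadj (k + (j - i - 1)) (by omega)
  · intro k hk0 hk
    dsimp only
    split_ifs with hki
    · exact hX k hk0 (by omega)
    · exact hX _ (by omega) (by omega)

theorem IsDetour.eraseLoop {X : Set V} {u v : V} {n : ℕ} {f : ℕ → V} (hf : IsDetour G X u v n f)
    {i j : ℕ} (hij : i < j) (hj : j ≤ n) (h : f i = f j) :
    ∃ m < n, ∃ g, IsDetour G X u v m g := by
  obtain ⟨h0, hn, hadj, hX⟩ := hf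
  refine ⟨n - (j - i), by omega, fun k => if k ≤ i then f k else f (k + (j - i)),
    by simpa using h0, ?_, ?_, ?_⟩
  · have h2 : n - (j - i) + (j - i) = n := by omega
    dsimp only
    split_ifs with h1
    · have h3 : n - (j - i) = i := by omega
      have h4 : j = n := by omega
      rw [h3, h, h4, hn]
    · rw [h2, hn]
  · intro k hk
    rcases lt_trichotomy k i with hki | rfl | hki
    · have h1 : k + 1 ≤ i := hki
      simpa only [hki.le, h1, if_true] using hadj k (by omega)
    · have h1 : ¬ k + 1 ≤ k := by omega
      have h2 : k + 1 + (j - k) = j + 1 := by omega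
      simpa only [le_refl, h1, if_true, if_false, h2, h] using hadj j (by omega)
    · have h1 : ¬ k ≤ i := by omega
      have h2 : ¬ k + 1 ≤ i := by omega
      have h3 : k + 1 + (j - i) = k + (j - i) + 1 := by omega
      simpa only [h1, h2, if_false, h3] using hadj (k + (j - i)) (by omega)
  · intro k hk0 hk
    dsimp only
    split_ifs with hki
    · exact hX k hk0 (by omega)
    · exact hX _ (by omega) (by omega)

/-- In a chordal graph, two neighbours of `a` that are joined by a path outside the closed
neighbourhood of `a` are adjacent. -/
theorem IsChordal.adj_of_avoids (hG : IsChordal G) {a u v x y : V} (hau : G.Adj a u)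
    (hav : G.Adj a v) (huv : u ≠ v) (hxy : Avoids G (closedNbhd G a) x y)
    (hx : x ∉ closedNbhd G a) (hux : G.Adj u x) (hvy : G.Adj v y) : G.Adj u v := by
  classical
  by_contra hnuv
  have hex : ∃ n, ∃ f, IsDetour G (closedNbhd G a) u v n f := hxy.exists_isDetour hx hux hvy.symm
  -- A shortest detour is an induced path; closing it through `a` gives an induced cycle of length
  -- `n + 2 ≥ 4`.
  obtain ⟨f, hf⟩ := Nat.find_spec hex
  have hmin : ∀ m < Nat.find hex, ¬ ∃ g, IsDetour G (closedNbhd G a) u v m g :=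
    fun m hm => Nat.find_min hex hm
  generalize Nat.find hex = n at hf hmin
  have hinj : ∀ i j, i < j → j ≤ n → f i ≠ f j := fun i j hij hj h => by
    obtain ⟨m, hm, g⟩ := hf.eraseLoop hij hj h
    exact hmin m hm g
  have hchord : ∀ i j, i + 1 < j → j ≤ n → ¬ G.Adj (f i) (f j) := fun i j hij hj h => by
    obtain ⟨m, hm, g⟩ := hf.shortcut hij hj h
    exact hmin m hm g
  obtain ⟨h0, hn, hadj, hX⟩ := hf
  have hn2 : 2 ≤ n := by
    by_contra hlt
    have : n = 0 ∨ n = 1 := by omega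
    rcases this with rfl | rfl
    · exact huv (h0 ▸ hn)
    · exact hnuv (by simpa [h0, hn] using hadj 0 one_pos)
  have hadj' : ∀ i j, i < j → j ≤ n → (G.Adj (f i) (f j) ↔ j = i + 1) := by
    refine fun i j hij hj => ⟨fun h => ?_, fun h => h ▸ hadj i (by omega)⟩
    by_contra hne
    exact hchord i j (by omega) hj h
  have hfa : ∀ i ≤ n, f i ≠ a := by
    intro i hi h
    rcases Nat.eq_zero_or_pos i with rfl | hpos
    · exact hau.ne (by rw [← h, h0])
    rcases hi.lt_or_eq with hlt | rfl
    · exact hX i hpos hlt (Or.inl h)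
    · exact hav.ne (by rw [← h, hn])
  have hfadj : ∀ i ≤ n, (G.Adj a (f i) ↔ i = 0 ∨ i = n) := by
    refine fun i hi => ⟨fun h => ?_, ?_⟩
    · by_contra hne
      push Not at hne
      exact hX i (by omega) (by omega) (Or.inr h)
    · rintro (rfl | rfl)
      · rwa [h0]
      · rwa [hn]
  let F : Fin (n + 2) → V := fun i => if i.1 ≤ n then f i.1 else a
  have hFinj : ∀ i j : Fin (n + 2), i < j → F i ≠ F j := by
    intro i j hij
    have h1 : i.1 < j.1 := hij
    have h2 : i.1 ≤ n := by omega
    simp only [F, h2, if_true]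
    split_ifs with h3
    · exact hinj _ _ h1 h3
    · exact hfa _ h2
  have hFadj : ∀ i j : Fin (n + 2), i < j →
      (G.Adj (F i) (F j) ↔ (SimpleGraph.cycleGraph (n + 2)).Adj i j) := by
    intro i j hij
    have h1 : i.1 < j.1 := hij
    have h2 : i.1 ≤ n := by omega
    have key : (SimpleGraph.cycleGraph (n + 2)).Adj i j ↔
        j.1 = i.1 + 1 ∨ (i.1 = 0 ∧ j.1 = n + 1) := by
      rw [SimpleGraph.cycleGraph_adj', Fin.coe_sub_iff_lt.mpr hij,
        Fin.coe_sub_iff_le.mpr hij.le]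
      omega
    rw [key]
    simp only [F, h2, if_true]
    split_ifs with h3
    · rw [hadj' _ _ h1 h3]
      omega
    · rw [G.adj_comm, hfadj _ h2]
      omega
  have hcontained : (SimpleGraph.cycleGraph (n + 2)).IsIndContained G := by
    refine ⟨⟨⟨F, fun i j h => ?_⟩, fun {i j} => ?_⟩⟩
    · rcases lt_trichotomy i j with hij | hij | hij
      · exact absurd h (hFinj i j hij)
      · exact hij
      · exact absurd h.symm (hFinj j i hij)
    · change G.Adj (F i) (F j) ↔ _
      rcases lt_trichotomy i j with hij | rfl | hij
      · exact hFadj i j hij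
      · simp
      · exact G.adj_comm _ _ |>.trans ((hFadj j i hij).trans (SimpleGraph.adj_comm _ _ _))
  have := hG (n + 2) (by omega) hcontained
  omega

end Chordal

end CopsRobbers

/-! ### Dominating cops and their answers -/

namespace CopsRobbers

open Relation

variable {V : Type*} {G : SimpleGraph V}

/-- A cop on `p` is at least as far from the robber's territory as a cop on `q`: no vertex that the
robber on `r` can reach outside the closed neighbourhood of `q` is in reach of `p`. -/
def Dominates (G : SimpleGraph V) (q p r : V) : Prop :=
  r ∉ closedNbhd G q ∧ ∀ v, Avoids G (closedNbhd G q) r v → v ∉ closedNbhd G p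

theorem Dominates.refl {q r : V} (h : r ∉ closedNbhd G q) : Dominates G q q r :=
  ⟨h, fun _ hv => hv.not_mem h⟩

theorem Dominates.not_mem {q p r : V} (h : Dominates G q p r) : r ∉ closedNbhd G p :=
  h.2 r .refl

/-- A vertex outside the robber's territory with a neighbour in it is a neighbour of the cop. -/
theorem adj_of_not_avoids {q r v w : V} (hr : r ∉ closedNbhd G q)
    (hv : Avoids G (closedNbhd G q) r v) (hvw : G.Adj v w)
    (hw : ¬ Avoids G (closedNbhd G q) r w) : G.Adj q w := by
  by_contra hqw
  refine hw (hv.step hr (.inr hvw) ?_)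
  rintro (rfl | h)
  · exact hv.not_mem hr (.inr hvw.symm)
  · exact hqw h

/-- A cop that enters the boundary of the robber's territory confines the robber to a part of it. -/
theorem IsChordal.avoids_of_step (hG : IsChordal G) {q a r v x y : V} (hr : r ∉ closedNbhd G q)
    (hqa : G.Adj q a) (hav : G.Adj a v) (hv : Avoids G (closedNbhd G q) r v)
    (hx : Avoids G (closedNbhd G q) r x) (hxy : y = x ∨ G.Adj x y) (hy : y ∉ closedNbhd G a) :
    Avoids G (closedNbhd G q) r y := by
  by_contra hn
  rcases hxy with rfl | hxy
  · exact hn hx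
  have hqy := adj_of_not_avoids hr hx hxy hn
  exact hy (.inr (hG.adj_of_avoids hqa hqy (fun h => hy (.inl h.symm)) (hv.symm.trans hx)
    (hv.not_mem hr) hav hxy.symm))

theorem IsChordal.avoids_of_avoids (hG : IsChordal G) {q a r v s w : V}
    (hr : r ∉ closedNbhd G q) (hqa : G.Adj q a) (hav : G.Adj a v)
    (hv : Avoids G (closedNbhd G q) r v) (hs : s = r ∨ G.Adj r s) (hsa : s ∉ closedNbhd G a)
    (hw : Avoids G (closedNbhd G a) s w) : Avoids G (closedNbhd G q) r w := by
  induction hw with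
  | refl => exact hG.avoids_of_step hr hqa hav hv .refl hs hsa
  | tail _ h ih => exact hG.avoids_of_step hr hqa hav hv ih (.inr h.1) h.2.2

/-- By domination `p'` is not in the territory of `q`, yet it touches it at `v`; so it is a boundary
vertex, hence a neighbour of `q`. -/
theorem Dominates.adj_of_mem {q p p' r v : V} (h : Dominates G q p r) (hp : p' ∈ closedNbhd G p)
    (hv : Avoids G (closedNbhd G q) r v) (hpv : v ∈ closedNbhd G p') :
    G.Adj q p' ∧ G.Adj p' v := by
  have hp' : ¬ Avoids G (closedNbhd G q) r p' := fun hc => h.2 _ hc hp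
  rcases hpv with rfl | hpv
  · exact absurd hv hp'
  · exact ⟨adj_of_not_avoids h.1 hv hpv.symm hp', hpv⟩

/-- A dominating cop can answer every move of the dominated one. -/
theorem IsChordal.exists_dominates (hG : IsChordal G) {q p p' r : V} (h : Dominates G q p r)
    (hp : p' ∈ closedNbhd G p) :
    ∃ q' ∈ closedNbhd G q, ∀ s, (s = r ∨ G.Adj r s) → s ∉ closedNbhd G q' →
      Dominates G q' p' s ∧
        ∀ w, Avoids G (closedNbhd G q') s w → Avoids G (closedNbhd G q) r w := by
  -- If the real cop now threatens the territory, the shadow joins it on `p'`; otherwise the shadow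
  -- stays put.
  by_cases hv : ∃ v, Avoids G (closedNbhd G q) r v ∧ v ∈ closedNbhd G p'
  · obtain ⟨v, hv, hpv⟩ := hv
    obtain ⟨hqp, hpv⟩ := h.adj_of_mem hp hv hpv
    exact ⟨p', .inr hqp, fun s hs hsp =>
      ⟨.refl hsp, fun w hw => hG.avoids_of_avoids h.1 hqp hpv hv hs hsp hw⟩⟩
  · push Not at hv
    refine ⟨q, .inl rfl, fun s hs hsq => ?_⟩
    have hrs : Avoids G (closedNbhd G q) r s := Avoids.step .refl h.1 hs hsq
    exact ⟨⟨hsq, fun w hw => hv w (hrs.trans hw)⟩, fun w hw => hrs.trans hw⟩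

/-- A dominating cop at distance two from the robber can moreover attack the robber. -/
theorem IsChordal.exists_dominates_attack (hG : IsChordal G) {q p p' r a : V}
    (h : Dominates G q p r) (hp : p' ∈ closedNbhd G p) (hqa : G.Adj q a) (har : G.Adj a r) :
    ∃ q' ∈ closedNbhd G q, G.Adj q' r ∧ ∀ s, (s = r ∨ G.Adj r s) → s ∉ closedNbhd G q' →
      Dominates G q' p' s ∧
        ∀ w, Avoids G (closedNbhd G q') s w → Avoids G (closedNbhd G q) r w := by
  by_cases hpr : G.Adj p' r
  · obtain ⟨hqp, -⟩ := h.adj_of_mem hp .refl (.inr hpr)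
    exact ⟨p', .inr hqp, hpr, fun s hs hsp =>
      ⟨.refl hsp, fun w hw => hG.avoids_of_avoids h.1 hqp hpr .refl hs hsp hw⟩⟩
  · refine ⟨a, .inr hqa, har, fun s hs hsa => ?_⟩
    have hsub : ∀ w, Avoids G (closedNbhd G a) s w → Avoids G (closedNbhd G q) r w :=
      fun w hw => hG.avoids_of_avoids h.1 hqa har .refl hs hsa hw
    refine ⟨⟨hsa, fun v hv hpv => ?_⟩, hsub⟩
    obtain ⟨hqp, hpv⟩ := h.adj_of_mem hp (hsub v hv) hpv
    have hap : a ≠ p' := fun hap => hpr (hap ▸ har)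
    have hadj : G.Adj a p' := hG.adj_of_avoids hqa hqp hap (hsub v hv) h.1 har hpv
    have hrs : G.Adj r s := by
      rcases hs with rfl | hs
      · exact absurd (.inr har) hsa
      · exact hs
    have hpr' : p' ≠ r := fun e => h.not_mem (e ▸ hp)
    -- `p'` and `r` are neighbours of `a` joined through `v` and `s` outside its closed
    -- neighbourhood, so they would be adjacent.
    exact hpr (hG.adj_of_avoids hadj har hpr' hv.symm (hv.not_mem hsa) hpv hrs)

/-- The vertices at distance at most two. -/
def secondNbhd (G : SimpleGraph V) (p : V) : Set V := {v | ∃ b ∈ closedNbhd G p, v ∈ closedNbhd G b}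

theorem closedNbhd_subset_secondNbhd (p : V) : closedNbhd G p ⊆ secondNbhd G p :=
  fun _ hv => ⟨p, .inl rfl, hv⟩

/-- A cop whose distance from the robber is at least three has a best move. -/
theorem IsChordal.exists_adj_boundary [Finite V] (hG : IsChordal G) (hconn : G.Connected)
    {p r : V} (hr : r ∉ secondNbhd G p) :
    ∃ b, G.Adj p b ∧ ∀ x y, Avoids G (secondNbhd G p) r x → G.Adj x y →
      ¬ Avoids G (secondNbhd G p) r y → G.Adj b y := by
  let B : Set V := {y | ¬ Avoids G (secondNbhd G p) r y ∧
    ∃ x, Avoids G (secondNbhd G p) r x ∧ G.Adj x y}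
  have hpr : r ≠ p := fun h => hr ⟨p, .inl rfl, .inl h⟩
  have hne : (G.neighborSet p).Nonempty := by
    have : Nontrivial V := ⟨r, p, hpr⟩
    exact hconn.preconnected.exists_adj_of_nontrivial p
  have hfar : ∀ x, Avoids G (secondNbhd G p) r x → ∀ b ∈ closedNbhd G p, x ∉ closedNbhd G b :=
    fun x hx b hb hxb => hx.not_mem hr ⟨b, hb, hxb⟩
  have hBp : ∀ y ∈ B, y ∉ closedNbhd G p := by
    rintro y ⟨-, x, hx, hxy⟩ hy
    exact hfar x hx y hy (.inr hxy.symm)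
  have hBb : ∀ y ∈ B, ∃ b, G.Adj p b ∧ G.Adj b y := by
    intro y hy
    obtain ⟨hy', x, hx, hxy⟩ := id hy
    have : y ∈ secondNbhd G p := by
      by_contra hc
      exact hy' (hx.step hr (.inr hxy) hc)
    obtain ⟨b, hb, hby⟩ := this
    rcases hby with rfl | hby
    · exact absurd hb (hBp _ hy)
    rcases hb with rfl | hb
    · exact absurd (.inr hby) (hBp _ hy)
    · exact ⟨b, hb, hby⟩
  -- Take `b` seeing a maximal part of the boundary `B`. If it misses `y`, seen by `b₂`, then `b₂`
  -- misses some `y₂` seen by `b`; chordality at `p` joins `b` to `b₂`, and then at `b` joins `b₂`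
  -- to `y₂`.
  obtain ⟨b, hpb, hmax⟩ := (Set.toFinite (G.neighborSet p)).exists_maximalFor
    (fun b => {y ∈ B | G.Adj b y}) _ hne
  refine ⟨b, hpb, fun x y hx hxy hy => ?_⟩
  by_contra hby
  have hyB : y ∈ B := ⟨hy, x, hx, hxy⟩
  obtain ⟨b₂, hpb₂, hb₂y⟩ := hBb y hyB
  have hnot : ¬ {y ∈ B | G.Adj b y} ⊆ {y ∈ B | G.Adj b₂ y} := fun hle =>
    hby (hmax hpb₂ hle ⟨hyB, hb₂y⟩).2
  obtain ⟨y₂, ⟨hy₂B, hby₂⟩, hy₂⟩ := Set.not_subset.mp hnot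
  have hb₂y₂ : ¬ G.Adj b₂ y₂ := fun h => hy₂ ⟨hy₂B, h⟩
  obtain ⟨-, x₂, hx₂, hxy₂⟩ := id hy₂B
  have hxx : Avoids G (secondNbhd G p) x₂ x := hx₂.symm.trans hx
  have hbb₂ : b ≠ b₂ := fun h => hby (h ▸ hb₂y)
  have hxp : ∀ x, Avoids G (secondNbhd G p) r x → x ∉ closedNbhd G p :=
    fun x hx => hfar x hx p (.inl rfl)
  have hadj : G.Adj b b₂ := by
    refine hG.adj_of_avoids (x := y₂) (y := y) hpb hpb₂ hbb₂ ?_ (hBp _ hy₂B) hby₂ hb₂y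
    exact ((hxx.anti (closedNbhd_subset_secondNbhd p)).tail
      ⟨hxy, hxp x hx, hBp y hyB⟩).head ⟨hxy₂.symm, hBp y₂ hy₂B, hxp x₂ hx₂⟩
  have hyb : y ∉ closedNbhd G b := by
    rintro (rfl | h)
    · exact hBp _ hyB (.inr hpb)
    · exact hby h
  refine hb₂y₂ (hG.adj_of_avoids (x := y) (y := x₂) hadj hby₂
    (fun h => hBp _ hy₂B (h ▸ .inr hpb₂)) ?_ hyb hb₂y hxy₂.symm)
  refine ReflTransGen.head ⟨hxy.symm, hyb, hfar x hx b (.inr hpb)⟩ ?_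
  exact hxx.symm.anti fun v hv => ⟨b, .inr hpb, hv⟩

end CopsRobbers

/-! ### Survival, and starting at distance two from a cop -/

namespace CopsRobbers

open Relation

variable {V : Type*} {G : SimpleGraph V} {k : ℕ}

/-- The robber on `r` can evade capture for `m` more rounds when the cops are on `P` and move
next. -/
def Survives (G : SimpleGraph V) : ℕ → (Fin k → V) → V → Prop
  | 0, P, r => ∀ i, P i ≠ r
  | m + 1, P, r => (∀ i, P i ≠ r) ∧ ∀ P' : Fin k → V, (∀ i, P' i ∈ closedNbhd G (P i)) →
      (∀ i, P' i ≠ r) ∧ ∃ s, (s = r ∨ G.Adj r s) ∧ Survives G m P' s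

theorem Survives.ne {m : ℕ} {P : Fin k → V} {r : V} (h : Survives G m P r) (i : Fin k) :
    P i ≠ r := by
  cases m with
  | zero => exact h i
  | succ m => exact h.1 i

theorem Survives.not_mem {m : ℕ} {P : Fin k → V} {r : V} (h : Survives G (m + 1) P r)
    (i : Fin k) : r ∉ closedNbhd G (P i) := by
  classical
  intro hr
  refine (h.2 (Function.update P i r) fun j => ?_).1 i (by simp)
  by_cases hj : j = i
  · subst hj; simpa using hr
  · rw [Function.update_of_ne hj]
    exact .inl rfl

theorem survives_one {P : Fin k → V} {r : V} (h : ∀ i, r ∉ closedNbhd G (P i)) :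
    Survives G 1 P r :=
  ⟨fun i e => h i (.inl e.symm), fun _ hP =>
    ⟨fun i e => h i (e ▸ hP i), r, .inl rfl, fun i e => h i (e ▸ hP i)⟩⟩

/-- Replacing cops by dominated ones does not harm the robber. -/
theorem IsChordal.survives_of_dominates (hG : IsChordal G) {m : ℕ} {Q P : Fin k → V} {r : V}
    (hQ : Survives G m Q r) (h : ∀ i, Dominates G (Q i) (P i) r) : Survives G m P r := by
  induction m generalizing Q P r with
  | zero => exact fun i e => (h i).not_mem (.inl e.symm)
  | succ m ih =>
    cases m with
    | zero => exact survives_one fun i => (h i).not_mem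
    | succ m =>
      refine ⟨fun i e => (h i).not_mem (.inl e.symm), fun P' hP =>
        ⟨fun i e => (h i).not_mem (e ▸ hP i), ?_⟩⟩
      choose Q' hQ' hdom using fun i => hG.exists_dominates (h i) (hP i)
      obtain ⟨-, s, hs, hsurv⟩ := hQ.2 Q' hQ'
      exact ⟨s, hs, ih hsurv fun i => (hdom i s hs (hsurv.not_mem i)).1⟩

/-- The vertices in reach of some cop. -/
def reach (G : SimpleGraph V) (P : Fin k → V) : Set V := ⋃ i, closedNbhd G (P i)

theorem not_mem_reach {P : Fin k → V} {r : V} :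
    r ∉ reach G P ↔ ∀ i, r ∉ closedNbhd G (P i) := by
  simp [reach]

theorem closedNbhd_subset_reach (P : Fin k → V) (i : Fin k) : closedNbhd G (P i) ⊆ reach G P :=
  Set.subset_iUnion (fun i => closedNbhd G (P i)) i

theorem exists_avoids_adj_reach (hconn : G.Connected) (hk : 0 < k) {P : Fin k → V} {r : V}
    (hr : r ∉ reach G P) :
    ∃ v, Avoids G (reach G P) r v ∧ ∃ j a, G.Adj (P j) a ∧ G.Adj a v := by
  by_contra hcon
  push Not at hcon
  have key : ∀ v, ReflTransGen G.Adj r v → Avoids G (reach G P) r v := by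
    intro v hv
    induction hv with
    | refl => exact .refl
    | @tail x y _ hxy ih =>
      refine ih.step hr (.inr hxy) fun hy => ?_
      obtain ⟨i, hi⟩ := Set.mem_iUnion.mp hy
      rcases hi with rfl | hi
      · exact ih.not_mem hr (closedNbhd_subset_reach P i (.inr hxy.symm))
      · exact hcon x ih i y hi hxy.symm
  have h0 := key (P ⟨0, hk⟩) ((SimpleGraph.reachable_iff_reflTransGen _ _).mp (hconn _ _))
  exact h0.not_mem hr (closedNbhd_subset_reach P ⟨0, hk⟩ (.inl rfl))

/-- If the robber can survive from some vertex, then he can do so from a vertex at distance two from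
some cop. -/
theorem IsChordal.exists_survives_near [Finite V] (hG : IsChordal G) (hconn : G.Connected)
    (hk : 0 < k) {m : ℕ} {P : Fin k → V} {r : V} (h : Survives G m P r) (hr : r ∉ reach G P) :
    ∃ v, Avoids G (reach G P) r v ∧ (∃ j a, G.Adj (P j) a ∧ G.Adj a v) ∧ Survives G m P v := by
  induction m generalizing P r with
  | zero =>
    obtain ⟨v, hv, hj⟩ := exists_avoids_adj_reach hconn hk hr
    exact ⟨v, hv, hj, fun i e => not_mem_reach.mp (hv.not_mem hr) i (.inl e.symm)⟩
  | succ m ih =>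
    cases m with
    | zero =>
      obtain ⟨v, hv, hj⟩ := exists_avoids_adj_reach hconn hk hr
      exact ⟨v, hv, hj, survives_one (not_mem_reach.mp (hv.not_mem hr))⟩
    | succ m =>
      by_cases hnear : ∃ j a, G.Adj (P j) a ∧ G.Adj a r
      · exact ⟨r, .refl, hnear, h⟩
      push Not at hnear
      have hr' := not_mem_reach.mp hr
      have hfar : ∀ i, r ∉ secondNbhd G (P i) := by
        rintro i ⟨b, hb, hbr⟩
        rcases hbr with rfl | hbr
        · exact hr' i hb
        rcases hb with rfl | hb
        · exact hr' i (.inr hbr)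
        · exact hnear i b hb hbr
      choose Q hPQ hQ using fun i => hG.exists_adj_boundary hconn (hfar i)
      obtain ⟨-, s, hs, hsurv⟩ := h.2 Q fun i => .inr (hPQ i)
      have hsQ : s ∉ reach G Q := not_mem_reach.mpr hsurv.not_mem
      have hstep : ∀ i x y, Avoids G (secondNbhd G (P i)) r x → (y = x ∨ G.Adj x y) →
          y ∉ closedNbhd G (Q i) → Avoids G (secondNbhd G (P i)) r y := by
        intro i x y hx hxy hy
        rcases hxy with rfl | hxy
        · exact hx
        by_contra hn
        exact hy (.inr (hQ i x y hx hxy hn))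
      -- `Q i` sees the whole boundary of the robber's component outside the second neighbourhood of
      -- `P i`, so he cannot leave it.
      have hsub : ∀ i w, Avoids G (closedNbhd G (Q i)) s w →
          Avoids G (secondNbhd G (P i)) r w := by
        intro i w hw
        induction hw with
        | refl => exact hstep i r s .refl hs (hsurv.not_mem i)
        | tail _ h ih => exact hstep i _ _ ih (.inr h.1) h.2.2
      obtain ⟨v, hv, ⟨j, a, hja, hav⟩, hvS⟩ := ih hsurv hsQ
      have hvi : ∀ i, Avoids G (closedNbhd G (Q i)) s v :=
        fun i => hv.anti (closedNbhd_subset_reach Q i)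
      have hv2 : ∀ i, v ∉ secondNbhd G (P i) := fun i => (hsub i v (hvi i)).not_mem (hfar i)
      have haP : ∀ i, a ∉ closedNbhd G (P i) := fun i ha => hv2 i ⟨a, ha, .inr hav⟩
      have hreach : ∀ w, Avoids G (reach G Q) s w → w ∉ reach G P := fun w hw =>
        not_mem_reach.mpr fun i hwi =>
          (hsub i w (hw.anti (closedNbhd_subset_reach Q i))).not_mem (hfar i)
            (closedNbhd_subset_secondNbhd _ hwi)
      have hrw : ∀ w, Avoids G (reach G Q) s w → Avoids G (reach G P) r w := by
        intro w hw
        induction hw with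
        | refl => exact Avoids.step .refl hr hs (hreach s .refl)
        | tail hsw h ih => exact ih.step hr (.inr h.1) (hreach _ (hsw.tail h))
      -- Starting on `a`, at distance two from `P j` via `Q j`, the robber answers any first cop
      -- move `P'` by going to `v`. There `Q` dominates `P'`, as the territory stays at distance at
      -- least three from every `P i`.
      refine ⟨a, (hrw v hv).step hr (.inr hav.symm) (not_mem_reach.mpr haP),
        ⟨j, Q j, hPQ j, hja⟩, fun i e => haP i (.inl e.symm), fun P' hP =>
          ⟨fun i e => haP i (e ▸ hP i), v, .inr hav, ?_⟩⟩
      refine hG.survives_of_dominates hvS fun i => ⟨hvS.not_mem i, fun w hw hwP => ?_⟩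
      exact (hsub i w ((hvi i).trans hw)).not_mem (hfar i) ⟨P' i, hP i, hwP⟩

/-! ### From survival to damage -/

/-- Against `σ`, with the moves in `h` already made, the robber on `r` can damage `m` more vertices
outside `X`. -/
def CanDamage (σ : CopStrategy G k) : ℕ → List V → V → Set V → Prop
  | 0, _, _, _ => True
  | m + 1, h, r, X => r ∉ X ∧ (∀ i, σ.pos (r :: h) i ≠ r) ∧
      ∃ s, (s = r ∨ G.Adj r s) ∧ (∀ i, σ.pos (r :: h) i ≠ s) ∧ CanDamage σ m (r :: h) s (insert r X)

theorem CopStrategy.mem_closedNbhd (σ : CopStrategy G k) (h : List V) (v : V) (i : Fin k) :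
    σ.pos (v :: h) i ∈ closedNbhd G (σ.pos h i) :=
  σ.legal h v i

/-- Each damaged vertex in `X` lies outside the territory of some shadow. Territories shrink, so
this persists and the robber never revisits it. -/
theorem IsChordal.canDamage (hG : IsChordal G) (σ : CopStrategy G k) {m : ℕ} {h : List V} {r : V}
    {Q : Fin k → V} {X : Set V} (hdom : ∀ i, Dominates G (Q i) (σ.pos h i) r)
    (hnear : ∃ j a, G.Adj (Q j) a ∧ G.Adj a r) (hS : Survives G m Q r)
    (hX : ∀ x ∈ X, ∃ i, ¬ Avoids G (closedNbhd G (Q i)) r x) : CanDamage σ m h r X := by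
  induction m generalizing h r Q X with
  | zero => trivial
  | succ m ih =>
    have hne : ∀ i, σ.pos (r :: h) i ≠ r := fun i e =>
      (hdom i).not_mem (by simpa only [e] using σ.mem_closedNbhd h r i)
    refine ⟨fun hr => (hX r hr).elim fun i hi => hi .refl, hne, ?_⟩
    cases m with
    -- The last vertex is damaged by merely standing still for one round.
    | zero => exact ⟨r, .inl rfl, hne, trivial⟩
    | succ m =>
      obtain ⟨j, a, hja, har⟩ := hnear
      have hmove : ∀ i, ∃ q ∈ closedNbhd G (Q i), (i = j → G.Adj q r) ∧
          ∀ s, (s = r ∨ G.Adj r s) → s ∉ closedNbhd G q →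
            Dominates G q (σ.pos (r :: h) i) s ∧
              ∀ w, Avoids G (closedNbhd G q) s w → Avoids G (closedNbhd G (Q i)) r w := by
        intro i
        by_cases hij : i = j
        · subst hij
          obtain ⟨q, hq, hqr, H⟩ :=
            hG.exists_dominates_attack (hdom i) (σ.mem_closedNbhd h r i) hja har
          exact ⟨q, hq, fun _ => hqr, H⟩
        · obtain ⟨q, hq, H⟩ := hG.exists_dominates (hdom i) (σ.mem_closedNbhd h r i)
          exact ⟨q, hq, fun e => absurd e hij, H⟩
      choose Q' hQ' hatt H using hmove
      obtain ⟨-, s, hs, hsurv⟩ := hS.2 Q' hQ'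
      have H' := fun i => H i s hs (hsurv.not_mem i)
      have hjr : G.Adj (Q' j) r := hatt j rfl
      -- Staying on `r` would leave the robber next to the attacking shadow with a round still to
      -- survive.
      have hrs : G.Adj r s := by
        rcases hs with rfl | hs
        · exact absurd (.inr hjr) (hsurv.not_mem j)
        · exact hs
      refine ⟨s, hs, fun i e => (H' i).1.not_mem (.inl e.symm),
        ih (fun i => (H' i).1) ⟨j, r, hjr, hrs⟩ hsurv ?_⟩
      rintro x (rfl | hx)
      · exact ⟨j, fun hc => hc.not_mem (hsurv.not_mem j) (.inr hjr)⟩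
      · obtain ⟨i, hi⟩ := hX x hx
        exact ⟨i, fun hc => hi ((H' i).2 x hc)⟩

/-- The first `t` terms of `q`, most recent first, put before `h`. -/
def pushHistory (q : ℕ → V) (h : List V) : ℕ → List V
  | 0 => h
  | t + 1 => q t :: pushHistory q h t

theorem pushHistory_cons (q : ℕ → V) (h : List V) (t : ℕ) :
    pushHistory q h (t + 1) = pushHistory (fun n => q (n + 1)) (q 0 :: h) t := by
  induction t with
  | zero => rfl
  | succ t ih => rw [pushHistory, ih, pushHistory]

theorem CanDamage.exists_play {σ : CopStrategy G k} {m : ℕ} {h : List V} {r : V} {X : Set V}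
    (H : CanDamage σ m h r X) :
    ∃ q : ℕ → V, q 0 = r ∧ (∀ t, q (t + 1) = q t ∨ G.Adj (q t) (q (t + 1))) ∧
      (∀ t < m, q t ∉ X) ∧ (∀ s t, s < t → t < m → q s ≠ q t) ∧
      ∀ t < m, ∀ i, σ.pos (pushHistory q h (t + 1)) i ≠ q t ∧
        σ.pos (pushHistory q h (t + 1)) i ≠ q (t + 1) := by
  induction m generalizing h r X with
  | zero => exact ⟨fun _ => r, rfl, fun _ => .inl rfl, by simp, by simp, by simp⟩
  | succ m ih =>
    obtain ⟨hrX, hr, s, hs, hσ, H⟩ := H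
    obtain ⟨q, rfl, hleg, hqX, hinj, hq⟩ := ih H
    let f : ℕ → V := fun | 0 => r | t + 1 => q t
    refine ⟨f, rfl, ?_, ?_, ?_, ?_⟩
    · rintro (_ | t)
      · exact hs
      · exact hleg t
    · rintro (_ | t) ht
      · exact hrX
      · exact fun hc => hqX t (by omega) (.inr hc)
    · rintro (_ | s) (_ | t) hst ht
      · omega
      · exact fun e => hqX t (by omega) (.inl e.symm)
      · omega
      · exact hinj s t (by omega) (by omega)
    · rintro (_ | t) ht i
      · exact ⟨hr i, hσ i⟩
      · rw [pushHistory_cons]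
        exact hq t (by omega) i

theorem IsChordal.exists_le_encard_damaged [Finite V] (hG : IsChordal G) (hconn : G.Connected)
    (hk : 0 < k) (σ : CopStrategy G k) {m : ℕ} {r : V} (h : Survives G m (σ.pos []) r) :
    ∃ ρ : RobberPlay G, (m : ℕ∞) ≤ (damaged σ ρ).encard := by
  cases m with
  | zero => exact ⟨⟨fun _ => r, fun _ => .inl rfl⟩, by simp⟩
  | succ m =>
    obtain ⟨v, -, hnear, hv⟩ :=
      hG.exists_survives_near hconn hk h (not_mem_reach.mpr h.not_mem)
    obtain ⟨q, rfl, hleg, -, hinj, hq⟩ := (hG.canDamage σ (h := []) (X := ∅)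
      (fun i => Dominates.refl (hv.not_mem i)) hnear hv (by simp)).exists_play
    let ρ : RobberPlay G := ⟨q, hleg⟩
    have hhist : ∀ t, ρ.history t = pushHistory q [] t := by
      intro t
      induction t with
      | zero => rfl
      | succ t ih => rw [RobberPlay.history, ih]; rfl
    have hfree : ∀ s ≤ m + 1, ¬ CaughtIn σ ρ s := by
      rintro (_ | s) hs
      · rintro ⟨i, hi⟩
        exact hv.ne i hi
      · rintro ⟨i, hi⟩
        rw [CopStrategy.posAt, hhist] at hi
        exact hi.elim (hq s (by omega) i).1 (hq s (by omega) i).2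
    refine ⟨ρ, ?_⟩
    have hsub : q '' Set.Iio (m + 1) ⊆ damaged σ ρ := by
      rintro _ ⟨t, ht, rfl⟩
      exact ⟨t, rfl, fun s hs => hfree s (hs.trans ht)⟩
    have hinj' : Set.InjOn q (Set.Iio (m + 1)) := by
      intro s hs t ht e
      rcases lt_trichotomy s t with h | h | h
      · exact absurd e (hinj s t h ht)
      · exact h
      · exact absurd e.symm (hinj t s h hs)
    calc ((m + 1 : ℕ) : ℕ∞) = (Set.Iio (m + 1)).encard := by
          rw [← Finset.coe_Iio, Set.encard_coe_eq_coe_finsetCard]; simp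
      _ = (q '' Set.Iio (m + 1)).encard := hinj'.encard_image.symm
      _ ≤ _ := Set.encard_le_encard hsub

end CopsRobbers

/-! ### Comparing capture time and damage for fixed `k` -/

namespace CopsRobbers

variable {V : Type*} {G : SimpleGraph V} {k : ℕ}

/-- The move is made total, with the cops staying put when there is nothing to exploit, so that
`choose` yields a legal strategy. -/
theorem exists_copMove (m : ℕ) (P : Fin k → V) (r : V) :
    ∃ P' : Fin k → V, (∀ i, P' i ∈ closedNbhd G (P i)) ∧
      (¬ Survives G (m + 1) P r → (∀ i, P i ≠ r) → (∀ i, P' i ≠ r) →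
        ∀ s, (s = r ∨ G.Adj r s) → ¬ Survives G m P' s) := by
  by_cases h : (∀ i, P i ≠ r) ∧ ¬ Survives G (m + 1) P r
  · obtain ⟨hP, hS⟩ := h
    rw [Survives] at hS
    push Not at hS
    obtain ⟨P', hP', H⟩ := hS hP
    exact ⟨P', hP', fun _ _ => H⟩
  · exact ⟨P, fun i => .inl rfl, fun h1 h2 => absurd ⟨h2, h1⟩ h⟩

theorem captureRound_le {σ : CopStrategy G k} {ρ : RobberPlay G} {t : ℕ} (h : CaughtIn σ ρ t) :
    captureRound σ ρ ≤ t :=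
  iInf₂_le t h

/-- If the robber cannot survive `m` rounds from any starting vertex, the cops capture him within
`m` rounds. -/
theorem capt_le_of_not_survives {m : ℕ} {P : Fin k → V} (h : ∀ r, ¬ Survives G m P r) :
    capt G k ≤ m := by
  choose next hnext hmove using exists_copMove (G := G) (k := k)
  -- The length of the history gives the round, hence the number of rounds still available.
  let pos : List V → Fin k → V := fun l =>
    List.rec P (fun v h p => next (m - (h.length + 1)) p v) l
  let σ : CopStrategy G k := ⟨pos, fun h v i => hnext (m - (h.length + 1)) (pos h) v i⟩
  refine iInf_le_of_le σ (iSup_le fun ρ => ?_)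
  have hlen : ∀ t, (ρ.history t).length = t := by
    intro t
    induction t with
    | zero => rfl
    | succ t ih => rw [RobberPlay.history, List.length_cons, ih]
  by_contra hlt
  have hfree : ∀ t ≤ m, ¬ CaughtIn σ ρ t := fun t ht hc =>
    hlt ((captureRound_le hc).trans (by exact_mod_cast ht))
  have hne : ∀ t ≤ m, ∀ i, σ.posAt ρ t i ≠ ρ.pos t := by
    rintro (_ | t) ht i hi
    · exact hfree 0 ht ⟨i, hi⟩
    · exact hfree (t + 1) ht ⟨i, .inr hi⟩
  have key : ∀ t ≤ m, ¬ Survives G (m - t) (σ.posAt ρ t) (ρ.pos t) := by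
    intro t ht
    induction t with
    | zero => exact h _
    | succ t ih =>
      have hpos : σ.posAt ρ (t + 1) = next (m - (t + 1)) (σ.posAt ρ t) (ρ.pos t) := by
        change next (m - ((ρ.history t).length + 1)) _ _ = _
        rw [hlen]
        rfl
      have h1 := ih (by omega)
      rw [show m - t = m - (t + 1) + 1 by omega] at h1
      rw [hpos]
      refine hmove _ _ _ h1 (hne t (by omega)) (fun i hi => hfree (t + 1) ht ⟨i, .inl ?_⟩) _
        (ρ.legal t)
      rw [hpos, hi]
  refine key m le_rfl ?_
  rw [Nat.sub_self]
  exact hne m le_rfl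

theorem IsChordal.capt_le_dmg_add_one [Finite V] (hG : IsChordal G) (hconn : G.Connected)
    (hk : 0 < k) : capt G k ≤ dmg G k + 1 := by
  rcases eq_or_ne (dmg G k) ⊤ with htop | htop
  · simp [htop]
  obtain ⟨d, hd⟩ := ENat.ne_top_iff_exists.mp htop
  have hlt : dmg G k < ((d + 1 : ℕ) : ℕ∞) := by
    rw [← hd]; exact_mod_cast Nat.lt_succ_self d
  obtain ⟨σ, hσ⟩ := iInf_lt_iff.mp hlt
  rw [← hd]
  refine capt_le_of_not_survives (m := d + 1) (P := σ.pos []) fun r hr => ?_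
  obtain ⟨ρ, hρ⟩ := hG.exists_le_encard_damaged hconn hk σ hr
  exact absurd ((hρ.trans (le_iSup (fun ρ => (damaged σ ρ).encard) ρ)).trans_lt hσ) (lt_irrefl _)

theorem encard_damaged_le {σ : CopStrategy G k} {ρ : RobberPlay G} {m : ℕ}
    (h : captureRound σ ρ < ((m + 2 : ℕ) : ℕ∞)) : (damaged σ ρ).encard ≤ m := by
  simp only [captureRound, iInf_lt_iff] at h
  obtain ⟨s, hs, hsm⟩ := h
  have hsm : s < m + 2 := by exact_mod_cast hsm
  have hsub : damaged σ ρ ⊆ ρ.pos '' Set.Iio m := by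
    rintro v ⟨t, rfl, ht⟩
    -- Damage at time `t` needs `t + 1 < s ≤ m + 1`, hence `t < m`.
    refine ⟨t, ?_, rfl⟩
    by_contra hc
    exact ht s (by simp only [Set.mem_Iio] at hc; omega) hs
  calc (damaged σ ρ).encard ≤ (ρ.pos '' Set.Iio m).encard := Set.encard_le_encard hsub
    _ ≤ (Set.Iio m).encard := Set.encard_image_le _ _
    _ = m := by rw [← Finset.coe_Iio, Set.encard_coe_eq_coe_finsetCard]; simp

theorem dmg_le_of_capt_le {m : ℕ} (h : capt G k ≤ (m + 1 : ℕ)) : dmg G k ≤ m := by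
  have hlt : capt G k < ((m + 2 : ℕ) : ℕ∞) :=
    h.trans_lt (by exact_mod_cast Nat.lt_succ_self (m + 1))
  obtain ⟨σ, hσ⟩ := iInf_lt_iff.mp hlt
  exact iInf_le_of_le σ (iSup_le fun ρ =>
    encard_damaged_le ((le_iSup (captureRound σ) ρ).trans_lt hσ))

theorem one_le_capt [Fintype V] (hk : k < Fintype.card V) : 1 ≤ capt G k := by
  refine le_iInf fun σ => ?_
  have hns : ¬ Function.Surjective (σ.pos []) := fun hs => by
    have := Fintype.card_le_of_surjective _ hs
    simp at this
    omega
  obtain ⟨r, hr⟩ := not_forall.mp hns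
  refine le_iSup_of_le ⟨fun _ => r, fun _ => .inl rfl⟩ (le_iInf₂ fun t ht => ?_)
  cases t with
  | zero => exact absurd ht hr
  | succ t => exact_mod_cast Nat.succ_le_succ (Nat.zero_le t)

theorem dmg_add_one_le_capt [Fintype V] (hk : k < Fintype.card V) : dmg G k + 1 ≤ capt G k := by
  rcases eq_or_ne (capt G k) ⊤ with htop | htop
  · simp [htop]
  obtain ⟨c, hc⟩ := ENat.ne_top_iff_exists.mp htop
  have h1 : 1 ≤ c := by
    have := one_le_capt (G := G) hk
    rw [← hc] at this
    exact_mod_cast this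
  obtain ⟨m, rfl⟩ := Nat.exists_eq_add_of_le' h1
  rw [← hc]
  push_cast
  gcongr
  exact dmg_le_of_capt_le hc.ge

/-- All but one of the vertices suffice for the cops to win in one round. -/
theorem capt_card_sub_one_le [Fintype V] [Nontrivial V] (hconn : G.Connected) :
    capt G (Fintype.card V - 1) ≤ 1 := by
  classical
  obtain ⟨w⟩ := hconn.nonempty
  have hcard : Fintype.card {v : V // v ≠ w} = Fintype.card V - 1 := by
    simp [Fintype.card_subtype_compl]
  let e := Fintype.equivFinOfCardEq hcard
  have hcover : ∀ v, v ≠ w → ∃ i, (e.symm i : V) = v := fun v hv => ⟨e ⟨v, hv⟩, by simp⟩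
  refine capt_le_of_not_survives (m := 1) (P := fun i => (e.symm i : V)) fun r hr => ?_
  by_cases hrw : r = w
  · subst hrw
    obtain ⟨v, hv⟩ := hconn.preconnected.exists_adj_of_nontrivial r
    obtain ⟨i, hi⟩ := hcover v hv.ne'
    exact hr.not_mem i (.inr (by simpa [hi] using hv.symm))
  · obtain ⟨i, hi⟩ := hcover r hrw
    exact hr.ne i hi

end CopsRobbers

theorem mainTheorem5 {V : Type*} [Fintype V] [Nontrivial V] (G : SimpleGraph V)
    (hconn : G.Connected) (hchordal : CopsRobbers.IsChordal G) :
    CopsRobbers.damageThrottling G + 1 = CopsRobbers.copThrottling G := by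
  have hn : 1 < Fintype.card V := Fintype.one_lt_card
  have hle : ∀ k, 1 ≤ k → k ≤ Fintype.card V →
      CopsRobbers.damageThrottling G ≤ k + CopsRobbers.dmg G k := fun k h1 h2 =>
    iInf₂_le k (Finset.mem_Icc.mpr ⟨h1, h2⟩)
  apply le_antisymm
  · refine le_iInf₂ fun k hk => ?_
    obtain ⟨hk1, hkn⟩ := Finset.mem_Icc.mp hk
    rcases hkn.lt_or_eq with hlt | heq
    · calc CopsRobbers.damageThrottling G + 1 ≤ k + CopsRobbers.dmg G k + 1 := by
            gcongr
            exact hle k hk1 hkn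
        _ = k + (CopsRobbers.dmg G k + 1) := add_assoc _ _ _
        _ ≤ k + CopsRobbers.capt G k := by
            gcongr
            exact CopsRobbers.dmg_add_one_le_capt hlt
    -- With a cop for every vertex the termwise inequality can fail, so this term is compared with
    -- that of one cop fewer, which has no damage.
    · have hd : CopsRobbers.dmg G (Fintype.card V - 1) ≤ (0 : ℕ) :=
        CopsRobbers.dmg_le_of_capt_le (CopsRobbers.capt_card_sub_one_le hconn)
      calc CopsRobbers.damageThrottling G + 1
          ≤ (Fintype.card V - 1 : ℕ) + CopsRobbers.dmg G (Fintype.card V - 1) + 1 := by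
            gcongr
            exact hle _ (by omega) (by omega)
        _ ≤ (Fintype.card V - 1 : ℕ) + (0 : ℕ) + 1 := by gcongr
        _ = k := by
            rw [heq]
            norm_cast
            omega
        _ ≤ k + CopsRobbers.capt G k := le_self_add
  · obtain ⟨k, hk, heq⟩ : ∃ k ∈ Finset.Icc 1 (Fintype.card V),
        CopsRobbers.damageThrottling G = k + CopsRobbers.dmg G k := by
      obtain ⟨k, hk, h⟩ := Finset.exists_mem_eq_inf' (s := Finset.Icc 1 (Fintype.card V))
        ⟨1, Finset.mem_Icc.mpr ⟨le_rfl, hn.le⟩⟩ (fun k : ℕ => (k : ℕ∞) + CopsRobbers.dmg G k)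
      exact ⟨k, hk, (Finset.inf_eq_iInf _ _).symm.trans ((Finset.inf'_eq_inf _ _).symm.trans h)⟩
    rw [heq, add_assoc]
    refine (iInf₂_le k hk).trans ?_
    gcongr
    exact hchordal.capt_le_dmg_add_one hconn (Finset.mem_Icc.mp hk).1
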